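/- Let $\mathcal S=\{1,\dots,S\}$ and let $\alpha:[0,1]\to[0,1]$ be a nonincreasing noise schedule with $\alpha_0=1$. For a probability distribution $\pi$ on $\mathcal S$, the forward process with stationary distribution $\pi$ has marginals $x_t=\alpha_t x_0+(1-\alpha_t)\pi$, and for $0\le s\le t\le 1$ with $\alpha_s>0$ its transition kernel is $$q^{\pi}_{t\mid s}(y\mid x)=\frac{\alpha_t}{\alpha_s}\,\mathbf 1\{y=x\}+\Bigl(1-\frac{\alpha_t}{\alpha_s}\Bigr)\pi(y).$$ Masking diffusion $q^{M}_{t\mid s}$ is the case $\pi=e_M$ for a mask state $M\in\mathcal S$, and uniform diffusion $q^{U}_{t\mid s}$ is the case $\pi=\frac1S\mathbf 1$. For a probability distribution $p$ on $\mathcal S$ and a kernel $K$ on $\mathcal S$, let $$\eta_{KL}(p,K)=\sup_{q:\,0<D_{KL}(q\Vert p)<\infty}\frac{D_{KL}(Kq\Vert Kp)}{D_{KL}(q\Vert p)},\qquad \eta_{KL}(K)=\sup_{p}\eta_{KL}(p,K),$$ where the suprema run over probability distributions on $\mathcal S$ and the supremum of the empty set is $0$. **Theorem.** Let $0\le s\le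 t\le 1$ with $\alpha_s>0$. 1. For all probability distributions $\pi,p_s,q_s$ on $\mathcal S$, $$D_{KL}(q^{\pi}_{t\mid s}q_s\Vert q^{\pi}_{t\mid s}p_s)\le \eta_{KL}(p_s,q^{\pi}_{t\mid s})\,D_{KL}(q_s\Vert p_s),$$ whenever the right-hand side is not of the form $0\cdot\infty$ (in particular whenever $D_{KL}(q_s\Vert p_s)<\infty$). 2. (Masking.) If $p_s$ gives positive mass to at least two states other than $M$, then $\eta_{KL}(p_s,q^{M}_{t\mid s})=\alpha_t/\alpha_s$. 3. (Uniform.) For every $p_s$, $$\eta_{KL}(p_s,q^{U}_{t\mid s})\le\frac{S\,(\alpha_t/\alpha_s)^2}{(S-2)\,\alpha_t/\alpha_s+2}.$$ 4. (Masking is the worst case.) For every $\pi$ and every $p_s$ one has $\eta_{KL}(p_s,q^{\pi}_{t\mid s})\le\alpha_t/\alpha_s$. Consequently, for every mask state $M$, one has $\eta_{KL}(p_s,q^{\pi}_{t\mid s})\le\eta_{KL}(p_s,q^{M}_{t\mid s})$ if $p_s$ gives positive mass to at least two states other than $M$. Moreover $\eta_{KL}(q^{\pi}_{t\mid s})\le\eta_{KL}(q^{M}_{t\mid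 s})$ for all $\pi$ and $M$. -/

import Mathlib

open MeasureTheory ProbabilityTheory InformationTheory
open scoped ENNReal

namespace DiscreteDiffusion

/-- A noise schedule on `[0, 1]`: it starts at `1`, is nonincreasing and stays nonnegative. -/
structure IsNoiseSchedule (α : ℝ → ℝ) : Prop where
  map_zero : α 0 = 1
  antitoneOn : AntitoneOn α (Set.Icc 0 1)
  nonneg : ∀ t ∈ Set.Icc (0 : ℝ) 1, 0 ≤ α t

/-- The forward transition kernel `q_{t|s}` of the corruption process with schedule `α` and
stationary distribution `π`: from state `x`, stay at `x` with probability `α t / α s`,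
otherwise draw a fresh state from `π`. -/
noncomputable def forwardKernel {S : ℕ} (α : ℝ → ℝ) (π : Measure (Fin S)) (s t : ℝ) :
    Kernel (Fin S) (Fin S) :=
  Kernel.ofFunOfCountable fun x =>
    ENNReal.ofReal (α t / α s) • Measure.dirac x + ENNReal.ofReal (1 - α t / α s) • π

/-- Masking diffusion: the stationary distribution is the point mass at the mask state `M`. -/
noncomputable def maskingKernel {S : ℕ} (α : ℝ → ℝ) (M : Fin S) (s t : ℝ) :
    Kernel (Fin S) (Fin S) :=
  forwardKernel α (Measure.dirac M) s t

/-- Uniform diffusion: the stationary distribution is uniform on the `S` states. -/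
noncomputable def uniformKernel (S : ℕ) (α : ℝ → ℝ) (s t : ℝ) : Kernel (Fin S) (Fin S) :=
  forwardKernel α (uniformOn Set.univ) s t

/-- The input-dependent strong data processing constant of the channel `K` at the input
distribution `p`: the supremum of `D(K q ‖ K p) / D(q ‖ p)` over the probability distributions `q`
with `0 < D(q ‖ p) < ∞` (it is `0` if there is no such `q`). -/
noncomputable def etaKL {S : ℕ} (p : Measure (Fin S)) (K : Kernel (Fin S) (Fin S)) : ℝ≥0∞ :=
  ⨆ (q : ProbabilityMeasure (Fin S)) (_ : klDiv (q : Measure (Fin S)) p ≠ 0)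
    (_ : klDiv (q : Measure (Fin S)) p ≠ ∞),
    klDiv (K ∘ₘ (q : Measure (Fin S))) (K ∘ₘ p) / klDiv (q : Measure (Fin S)) p

/-- The input-independent constant: the worst case of `etaKL` over all input distributions. -/
noncomputable def etaKLSup {S : ℕ} (K : Kernel (Fin S) (Fin S)) : ℝ≥0∞ :=
  ⨆ p : ProbabilityMeasure (Fin S), etaKL (p : Measure (Fin S)) K

/-- One forward step is the update `x_t = (α_t / α_s) x_s + (1 - α_t / α_s) π`. -/
theorem forwardKernel_comp_measure {S : ℕ} (α : ℝ → ℝ) (π p : Measure (Fin S))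
    [IsProbabilityMeasure p] (s t : ℝ) :
    forwardKernel α π s t ∘ₘ p
      = ENNReal.ofReal (α t / α s) • p + ENNReal.ofReal (1 - α t / α s) • π := by
  ext A hA
  rw [Measure.bind_apply hA (Kernel.aemeasurable _)]
  have h : ∀ x, forwardKernel α π s t x A
      = ENNReal.ofReal (α t / α s) * A.indicator 1 x + ENNReal.ofReal (1 - α t / α s) * π A := by
    intro x
    change (ENNReal.ofReal (α t / α s) • Measure.dirac x
      + ENNReal.ofReal (1 - α t / α s) • π) A = _
    simp [Measure.dirac_apply' x hA]
  simp only [h]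
  rw [lintegral_add_right _ measurable_const, lintegral_const_mul _ (by fun_prop),
    lintegral_indicator_one hA]
  simp

/-- The marginals of the process are `x_t = α_t x_0 + (1 - α_t) π`, and the kernels `q_{t|s}`
transport them into each other. -/
theorem forwardKernel_comp_marginal {S : ℕ} {α : ℝ → ℝ} (hα : IsNoiseSchedule α)
    (π p₀ : Measure (Fin S)) [IsProbabilityMeasure π] [IsProbabilityMeasure p₀] {s t : ℝ}
    (hs : 0 ≤ s) (hst : s ≤ t) (ht : t ≤ 1) (hαs : 0 < α s) :
    forwardKernel α π s t ∘ₘ (ENNReal.ofReal (α s) • p₀ + ENNReal.ofReal (1 - α s) • π)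
      = ENNReal.ofReal (α t) • p₀ + ENNReal.ofReal (1 - α t) • π := by
  have h1 : α s ≤ 1 := hα.map_zero ▸ hα.antitoneOn (by simp) ⟨hs, hst.trans ht⟩ hs
  have h2 : α t ≤ α s := hα.antitoneOn ⟨hs, hst.trans ht⟩ ⟨hs.trans hst, ht⟩ hst
  have h3 : 0 ≤ α t := hα.nonneg t ⟨hs.trans hst, ht⟩
  have h4 : α t / α s ≤ 1 := (div_le_one hαs).2 h2
  have h5 : 0 ≤ α t / α s := by positivity
  have : IsProbabilityMeasure (ENNReal.ofReal (α s) • p₀ + ENNReal.ofReal (1 - α s) • π) := by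
    constructor
    simp only [Measure.coe_add, Measure.coe_smul, Pi.add_apply, Pi.smul_apply, measure_univ,
      smul_eq_mul, mul_one]
    rw [← ENNReal.ofReal_add hαs.le (by linarith)]
    simp
  rw [forwardKernel_comp_measure, smul_add, add_assoc, smul_smul, smul_smul, ← add_smul,
    ← ENNReal.ofReal_mul h5, ← ENNReal.ofReal_mul h5,
    ← ENNReal.ofReal_add (mul_nonneg h5 (by linarith)) (by linarith)]
  congr 3
  · field_simp
  · field_simp
    ring

end DiscreteDiffusion

open DiscreteDiffusion

/-!
Write `ρ = α t / α s`. One forward step sends a probability vector `p` to `ρ p + (1 - ρ) π`, and on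
a finite space the divergence is the sum `finKL`.

All upper bounds are chi-square estimates. Along the segment from `p` to `q` the divergence from `p`
vanishes to first order at `p`, and its second derivative is the chi-square form of `q - p` at the
current point. Hence a bound for the chi-square contraction ratio at every probability vector is a
bound for the contraction ratio of divergences (`finKL_le_of_segmentChiSq_le`,
`etaKL_forwardKernel_le`). For general `π`, dropping `π` from the output denominators gives the
ratio `ρ` term by term. For uniform `π` the term of an atom of mass `x` contracts by
`ρ² x / (ρ x + (1 - ρ) / S)`, which increases with `x`; its value at `x = 1 / 2` is the claimed
constant. At most one atom is heavier than `1 / 2`, and since `q - p` has total mass zero the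
Cauchy-Schwarz inequality lets the other atoms compensate for it
(`sum_sq_div_le_of_sum_eq_zero`).

For masking, the ratio is exactly `ρ` as soon as `q` and `p` agree at the mask state
(`finKL_stepVec_dirac`); moving mass between two unmasked atoms of `p` gives such a `q`. For the
input-independent constant one unmasked state is enough, in the limit of inputs that are almost
entirely masked (`ofReal_le_etaKLSup_maskingKernel`).
-/

/-! ### Divergence on a finite space -/

/-- The divergence `D(q ‖ p) = ∑ i, p i * klFun (q i / p i)` of nonnegative vectors with `q`
supported where `p` is; coordinates with `p i = 0` contribute `0`. -/
noncomputable def finKL {ι : Type*} [Fintype ι] (q p : ι → ℝ) : ℝ :=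
  ∑ i, p i * klFun (q i / p i)

lemma finKL_nonneg {ι : Type*} [Fintype ι] {q p : ι → ℝ} (hq : ∀ i, 0 ≤ q i)
    (hp : ∀ i, 0 ≤ p i) : 0 ≤ finKL q p :=
  Finset.sum_nonneg fun i _ => mul_nonneg (hp i) (klFun_nonneg (div_nonneg (hq i) (hp i)))

lemma absolutelyContinuous_of_singleton {S : ℕ} {q p : Measure (Fin S)}
    (h : ∀ i, p {i} = 0 → q {i} = 0) : q ≪ p := by
  intro A hA
  rw [measure_null_iff_singleton A.to_countable] at hA ⊢
  exact fun i hi => h i (hA i hi)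

lemma klDiv_eq_ofReal_finKL {S : ℕ} {q p : Measure (Fin S)} [IsFiniteMeasure q]
    [IsFiniteMeasure p] (h : q ≪ p) :
    klDiv q p = ENNReal.ofReal (finKL (fun i => q.real {i}) (fun i => p.real {i})) := by
  rw [klDiv_eq_lintegral_klFun_of_ac h, lintegral_fintype, finKL,
    ENNReal.ofReal_sum_of_nonneg fun i _ => mul_nonneg measureReal_nonneg
      (klFun_nonneg (div_nonneg measureReal_nonneg measureReal_nonneg))]
  refine Finset.sum_congr rfl fun i _ => ?_
  rw [ENNReal.ofReal_mul measureReal_nonneg, ofReal_measureReal, mul_comm]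
  by_cases h0 : p {i} = 0
  · simp [h0]
  congr 3
  have h1 := Measure.setLIntegral_rnDeriv h {i}
  rw [lintegral_singleton] at h1
  rw [measureReal_def, measureReal_def, ← h1, ENNReal.toReal_mul, mul_div_cancel_right₀]
  exact ENNReal.toReal_ne_zero.2 ⟨h0, measure_ne_top _ _⟩

/-! ### From chi-square contraction to contraction of divergences -/

section Segment

variable {ι κ : Type*} [Fintype ι] [Fintype κ]

/-- Every density ratio stays positive on the half-open segment from `p` towards `q`. Where `p i`
vanishes the ratio is `1`, by division by zero. -/
lemma one_add_mul_div_pos {a b u : ℝ} (ha : 0 ≤ a) (hb : 0 ≤ b) (h0 : 0 ≤ u) (h1 : u < 1) :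
    0 < 1 + u * ((b - a) / a) := by
  rcases ha.eq_or_lt with rfl | ha
  · simp
  have : 1 + u * ((b - a) / a) = ((1 - u) * a + u * b) / a := by field_simp; ring
  rw [this]
  have : 0 < (1 - u) * a := mul_pos (by linarith) ha
  positivity

/-- The divergence from `p` of the point `p + u (q - p)` of the segment from `p` to `q`. -/
noncomputable def segmentKL (q p : ι → ℝ) (u : ℝ) : ℝ :=
  ∑ i, p i * klFun (1 + u * ((q i - p i) / p i))

/-- The derivative of `segmentKL` in the segment parameter. -/
noncomputable def segmentKLDeriv (q p : ι → ℝ) (u : ℝ) : ℝ :=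
  ∑ i, p i * (Real.log (1 + u * ((q i - p i) / p i)) * ((q i - p i) / p i))

/-- The second derivative of `segmentKL`: the chi-square quadratic form of `q - p` at the point
`p + u (q - p)`. -/
noncomputable def segmentChiSq (q p : ι → ℝ) (u : ℝ) : ℝ :=
  ∑ i, (q i - p i) ^ 2 / (p i + u * (q i - p i))

lemma continuous_segmentKL (q p : ι → ℝ) : Continuous (segmentKL q p) := by
  unfold segmentKL
  fun_prop

lemma segmentKL_zero (q p : ι → ℝ) : segmentKL q p 0 = 0 := by
  simp [segmentKL, klFun_one]

lemma segmentKLDeriv_zero (q p : ι → ℝ) : segmentKLDeriv q p 0 = 0 := by simp [segmentKLDeriv]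

lemma segmentKL_one (q p : ι → ℝ) : segmentKL q p 1 = finKL q p := by
  refine Finset.sum_congr rfl fun i _ => ?_
  by_cases h : p i = 0
  · simp [h]
  · congr 2
    field_simp
    ring

lemma hasDerivAt_segmentKL {q p : ι → ℝ} (hq : ∀ i, 0 ≤ q i) (hp : ∀ i, 0 ≤ p i) {u : ℝ}
    (h0 : 0 ≤ u) (h1 : u < 1) : HasDerivAt (segmentKL q p) (segmentKLDeriv q p u) u := by
  refine HasDerivAt.fun_sum fun i _ => HasDerivAt.const_mul _ ?_
  have h := one_add_mul_div_pos (hp i) (hq i) h0 h1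
  refine HasDerivAt.comp (h₂ := klFun) (h := fun u => 1 + u * ((q i - p i) / p i)) u
    (hasDerivAt_klFun h.ne') ?_
  simpa using ((hasDerivAt_id u).mul_const ((q i - p i) / p i)).const_add 1

lemma hasDerivAt_segmentKLDeriv {q p : ι → ℝ} (hq : ∀ i, 0 ≤ q i) (hp : ∀ i, 0 ≤ p i)
    (hqp : ∀ i, p i = 0 → q i = 0) {u : ℝ} (h0 : 0 ≤ u) (h1 : u < 1) :
    HasDerivAt (segmentKLDeriv q p) (segmentChiSq q p u) u := by
  refine HasDerivAt.fun_sum fun i _ => ?_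
  have h := one_add_mul_div_pos (hp i) (hq i) h0 h1
  have h2 : HasDerivAt (fun u => 1 + u * ((q i - p i) / p i)) ((q i - p i) / p i) u := by
    simpa using ((hasDerivAt_id u).mul_const ((q i - p i) / p i)).const_add 1
  have h3 := ((h2.log h.ne').mul_const ((q i - p i) / p i)).const_mul (p i)
  refine h3.congr_deriv ?_
  by_cases h4 : p i = 0
  · simp [h4, hqp i h4]
  · have h5 : p i + u * (q i - p i) = p i * (1 + u * ((q i - p i) / p i)) := by field_simp
    rw [h5]
    have h6 := h.ne'
    generalize 1 + u * ((q i - p i) / p i) = z at h6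
    field_simp

/-- Both divergences vanish to first order at the start of the segment and have the chi-square
forms as second derivatives, so a comparison of these forms along the segment integrates twice to
a comparison of the divergences. -/
theorem finKL_le_of_segmentChiSq_le {q p : ι → ℝ} {Q P : κ → ℝ} (hq : ∀ i, 0 ≤ q i)
    (hp : ∀ i, 0 ≤ p i) (hqp : ∀ i, p i = 0 → q i = 0) (hQ : ∀ i, 0 ≤ Q i) (hP : ∀ i, 0 ≤ P i)
    (hQP : ∀ i, P i = 0 → Q i = 0) {C : ℝ}
    (h : ∀ u ∈ Set.Ioo (0 : ℝ) 1, segmentChiSq Q P u ≤ C * segmentChiSq q p u) :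
    finKL Q P ≤ C * finKL q p := by
  have d1 : ∀ u, 0 ≤ u → u < 1 → HasDerivAt (fun u => C * segmentKL q p u - segmentKL Q P u)
      (C * segmentKLDeriv q p u - segmentKLDeriv Q P u) u := fun u h0 h1 =>
    ((hasDerivAt_segmentKL hq hp h0 h1).const_mul C).sub (hasDerivAt_segmentKL hQ hP h0 h1)
  have d2 : ∀ u, 0 ≤ u → u < 1 → HasDerivAt
      (fun u => C * segmentKLDeriv q p u - segmentKLDeriv Q P u)
      (C * segmentChiSq q p u - segmentChiSq Q P u) u := fun u h0 h1 =>
    ((hasDerivAt_segmentKLDeriv hq hp hqp h0 h1).const_mul C).sub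
      (hasDerivAt_segmentKLDeriv hQ hP hQP h0 h1)
  have m2 : MonotoneOn (fun u => C * segmentKLDeriv q p u - segmentKLDeriv Q P u)
      (Set.Ico 0 1) := by
    refine monotoneOn_of_deriv_nonneg (convex_Ico 0 1)
      (fun u hu => (d2 u hu.1 hu.2).continuousAt.continuousWithinAt) ?_ ?_ <;>
      rw [interior_Ico] <;> intro u hu
    · exact (d2 u hu.1.le hu.2).differentiableAt.differentiableWithinAt
    · rw [(d2 u hu.1.le hu.2).deriv]
      exact sub_nonneg.2 (h u hu)
  have m1 : MonotoneOn (fun u => C * segmentKL q p u - segmentKL Q P u) (Set.Icc 0 1) := by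
    refine monotoneOn_of_deriv_nonneg (convex_Icc 0 1)
      (((continuous_segmentKL q p).const_mul C).sub (continuous_segmentKL Q P)).continuousOn
      ?_ ?_ <;> rw [interior_Icc] <;> intro u hu
    · exact (d1 u hu.1.le hu.2).differentiableAt.differentiableWithinAt
    · rw [(d1 u hu.1.le hu.2).deriv]
      simpa [segmentKLDeriv_zero] using
        m2 (Set.left_mem_Ico.2 zero_lt_one) ⟨hu.1.le, hu.2⟩ hu.1.le
  have := m1 (Set.left_mem_Icc.2 zero_le_one) (Set.right_mem_Icc.2 zero_le_one) zero_le_one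
  simp only [segmentKL_zero, segmentKL_one] at this
  linarith

end Segment

/-! ### Chi-square contraction of the symmetric channel -/

lemma inv_add_inv_le_of_add_eq_one {ρ c x y : ℝ} (hρ : 0 ≤ ρ) (hc : 0 ≤ c) (hA : 0 < ρ + 2 * c)
    (hx : 0 < x) (hy : 0 < y) (hxy : x + y = 1) :
    1 / (ρ * x + c) + 1 / (ρ * y + c) ≤ 1 / (ρ + 2 * c) * (1 / x + 1 / y) := by
  have pos : ∀ z, 0 < z → 0 < ρ * z + c := by
    intro z hz
    rcases hρ.eq_or_lt with rfl | hρ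
    · linarith
    · positivity
  have h1 := pos x hx
  have h2 := pos y hy
  rw [div_add_div _ _ h1.ne' h2.ne', div_add_div _ _ hx.ne' hy.ne', div_mul_div_comm,
    div_le_div_iff₀ (mul_pos h1 h2) (by positivity)]
  obtain rfl : y = 1 - x := by linarith
  have h3 : 0 ≤ c * (ρ + c) * (2 * x - 1) ^ 2 := by positivity
  nlinarith

/-- Chi-square contraction for a channel `ρ • id + c`. If no weight exceeds `1 / 2` the inequality
holds term by term; if `w k > 1 / 2`, the excess at `k` is paid for by the other coordinates, since
`d k = - ∑ j ≠ k, d j`. Two atoms of weight `1 / 2` give equality. -/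
lemma sum_sq_div_le_of_sum_eq_zero {ι : Type*} [Fintype ι] {ρ c : ℝ} (hρ : 0 ≤ ρ) (hc : 0 ≤ c)
    (hA : 0 < ρ + 2 * c) {w d : ι → ℝ} (hw : ∀ i, 0 ≤ w i) (hw1 : ∑ i, w i = 1)
    (hd : ∑ i, d i = 0) (hwd : ∀ i, w i = 0 → d i = 0) :
    ∑ i, d i ^ 2 / (ρ * w i + c) ≤ 1 / (ρ + 2 * c) * ∑ i, d i ^ 2 / w i := by
  classical
  have pos : ∀ z, 0 < z → 0 < ρ * z + c := by
    intro z hz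
    rcases hρ.eq_or_lt with rfl | hρ
    · linarith
    · positivity
  -- `z / (ρ * z + c)` is increasing in `z`.
  have term : ∀ y, 0 < y → ∀ i, w i ≤ y →
      d i ^ 2 / (ρ * w i + c) ≤ y / (ρ * y + c) * (d i ^ 2 / w i) := by
    intro y hy i hi
    by_cases h0 : w i = 0
    · simp [hwd i h0]
    have h1 : 0 < w i := (hw i).lt_of_ne' h0
    rw [div_mul_div_comm, div_le_div_iff₀ (pos _ h1) (mul_pos (pos _ hy) h1)]
    have h2 : (ρ * y + c) * w i ≤ y * (ρ * w i + c) := by nlinarith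
    nlinarith [mul_le_mul_of_nonneg_left h2 (sq_nonneg (d i))]
  by_cases hall : ∀ i, w i ≤ 1 / 2
  · rw [Finset.mul_sum]
    refine Finset.sum_le_sum fun i _ => (term (1 / 2) (by norm_num) i (hall i)).trans_eq ?_
    congr 1
    have := pos (1 / 2) (by norm_num)
    rw [div_eq_div_iff this.ne' hA.ne']
    ring
  push Not at hall
  obtain ⟨k, hk⟩ := hall
  set R := Finset.univ.erase k with hR
  have hkU : k ∈ Finset.univ := Finset.mem_univ k
  have hy : w k + ∑ j ∈ R, w j = 1 := by rw [Finset.add_sum_erase _ _ hkU, hw1]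
  have hdk : d k + ∑ j ∈ R, d j = 0 := by rw [Finset.add_sum_erase _ _ hkU, hd]
  have hle : ∀ j ∈ R, w j ≤ ∑ j ∈ R, w j := fun j hj =>
    Finset.single_le_sum (f := w) (fun i _ => hw i) hj
  have hy0 : 0 ≤ ∑ j ∈ R, w j := Finset.sum_nonneg fun i _ => hw i
  -- Cauchy-Schwarz, which also holds across zero weights.
  have hCS : (∑ j ∈ R, d j) ^ 2 ≤ (∑ j ∈ R, w j) * ∑ j ∈ R, d j ^ 2 / w j := by
    refine Finset.sum_sq_le_sum_mul_sum_of_sq_le_mul R (fun i _ => hw i)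
      (fun i _ => div_nonneg (sq_nonneg _) (hw i)) fun i _ => le_of_eq ?_
    by_cases h0 : w i = 0
    · simp [h0, hwd i h0]
    · field_simp
  set y := ∑ j ∈ R, w j
  have hT0 : 0 ≤ ∑ j ∈ R, d j ^ 2 / w j :=
    Finset.sum_nonneg fun i _ => div_nonneg (sq_nonneg _) (hw i)
  have hTsum : ∑ i, d i ^ 2 / w i = d k ^ 2 / w k + ∑ j ∈ R, d j ^ 2 / w j :=
    (Finset.add_sum_erase _ _ hkU).symm
  have hLsum : ∑ i, d i ^ 2 / (ρ * w i + c)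
      = d k ^ 2 / (ρ * w k + c) + ∑ j ∈ R, d j ^ 2 / (ρ * w j + c) :=
    (Finset.add_sum_erase _ _ hkU).symm
  have hkd : d k ^ 2 = (∑ j ∈ R, d j) ^ 2 := by
    rw [show d k = -∑ j ∈ R, d j by linarith, neg_sq]
  rw [hTsum, hLsum]
  rw [← hkd] at hCS
  rcases hy0.eq_or_lt with hy0 | hy0
  · have hz : ∀ j ∈ R, d j = 0 := fun j hj =>
      hwd j (le_antisymm ((hle j hj).trans_eq hy0.symm) (hw j))
    have h1 : d k = 0 := by
      have := Finset.sum_eq_zero hz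
      linarith
    rw [Finset.sum_eq_zero fun j hj => by rw [hz j hj]; simp,
      Finset.sum_eq_zero fun j hj => by rw [hz j hj]; simp, h1]
    simp
  have hx : 0 < w k := by linarith
  set T := ∑ j ∈ R, d j ^ 2 / w j
  have h1 : ∑ j ∈ R, d j ^ 2 / (ρ * w j + c) ≤ y / (ρ * y + c) * T := by
    rw [Finset.mul_sum]
    exact Finset.sum_le_sum fun j hj => term y hy0 j (hle j hj)
  have h2 := inv_add_inv_le_of_add_eq_one hρ hc hA hx hy0 hy
  have h3 : y / (ρ * y + c) ≤ 1 / (ρ + 2 * c) := by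
    rw [div_le_div_iff₀ (pos y hy0) hA]
    nlinarith
  have h4 : d k ^ 2 * (1 / y) ≤ T := by
    rw [mul_one_div, div_le_iff₀ hy0]
    linarith
  have h5 := mul_le_mul_of_nonneg_left h4 (sub_nonneg.2 h3)
  have h6 := mul_le_mul_of_nonneg_left h2 (sq_nonneg (d k))
  have h7 : y / (ρ * y + c) * (d k ^ 2 * (1 / y)) = d k ^ 2 * (1 / (ρ * y + c)) := by
    have := (pos y hy0).ne'
    field_simp
  rw [sub_mul, sub_mul, h7] at h5
  rw [div_eq_mul_one_div (d k ^ 2) (w k), div_eq_mul_one_div (d k ^ 2) (ρ * w k + c)]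
  nlinarith

/-! ### Contraction coefficients of the forward kernels -/

section Forward

variable {S : ℕ} {α : ℝ → ℝ} {s t : ℝ}

/-- The image of the probability vector `p` under one forward step with retention probability
`ρ`. -/
def stepVec (ρ : ℝ) (π p : Fin S → ℝ) (i : Fin S) : ℝ := ρ * p i + (1 - ρ) * π i

lemma div_mem_Icc_of_isNoiseSchedule (hα : IsNoiseSchedule α) (hs : 0 ≤ s) (hst : s ≤ t)
    (ht : t ≤ 1) (hαs : 0 < α s) : α t / α s ∈ Set.Icc (0 : ℝ) 1 :=
  ⟨div_nonneg (hα.nonneg t ⟨hs.trans hst, ht⟩) hαs.le,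
    (div_le_one hαs).2 (hα.antitoneOn ⟨hs, hst.trans ht⟩ ⟨hs.trans hst, ht⟩ hst)⟩

instance isFiniteMeasure_forwardKernel_comp (π p : Measure (Fin S)) [IsProbabilityMeasure π]
    [IsProbabilityMeasure p] : IsFiniteMeasure (forwardKernel α π s t ∘ₘ p) := by
  rw [forwardKernel_comp_measure]
  exact ⟨by simp⟩

lemma forwardKernel_comp_real_singleton (hρ : α t / α s ∈ Set.Icc (0 : ℝ) 1)
    (π p : Measure (Fin S)) [IsProbabilityMeasure π] [IsProbabilityMeasure p] (i : Fin S) :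
    (forwardKernel α π s t ∘ₘ p).real {i}
      = stepVec (α t / α s) (fun i => π.real {i}) (fun i => p.real {i}) i := by
  have h1 : 0 ≤ 1 - α t / α s := sub_nonneg.2 hρ.2
  rw [forwardKernel_comp_measure, measureReal_def, Measure.add_apply, Measure.smul_apply,
    Measure.smul_apply, smul_eq_mul,
    smul_eq_mul, ENNReal.toReal_add (by finiteness) (by finiteness), ENNReal.toReal_mul,
    ENNReal.toReal_mul, ENNReal.toReal_ofReal hρ.1,
    ENNReal.toReal_ofReal h1]
  rfl

lemma forwardKernel_comp_absolutelyContinuous (π : Measure (Fin S)) {q p : Measure (Fin S)}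
    [IsProbabilityMeasure q] [IsProbabilityMeasure p] (h : q ≪ p) :
    forwardKernel α π s t ∘ₘ q ≪ forwardKernel α π s t ∘ₘ p := by
  rw [forwardKernel_comp_measure, forwardKernel_comp_measure]
  intro A hA
  simp only [Measure.coe_add, Measure.coe_smul, Pi.add_apply, Pi.smul_apply, smul_eq_mul,
    add_eq_zero, mul_eq_zero] at hA ⊢
  exact ⟨hA.1.imp_right fun h0 => h h0, hA.2⟩

lemma klDiv_forwardKernel_comp (hρ : α t / α s ∈ Set.Icc (0 : ℝ) 1) (π : Measure (Fin S))
    {q p : Measure (Fin S)} [IsProbabilityMeasure π] [IsProbabilityMeasure q]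
    [IsProbabilityMeasure p] (h : q ≪ p) :
    klDiv (forwardKernel α π s t ∘ₘ q) (forwardKernel α π s t ∘ₘ p)
      = ENNReal.ofReal (finKL
          (stepVec (α t / α s) (fun i => π.real {i}) fun i => q.real {i})
          (stepVec (α t / α s) (fun i => π.real {i}) fun i => p.real {i})) := by
  rw [klDiv_eq_ofReal_finKL (forwardKernel_comp_absolutelyContinuous π h)]
  simp only [forwardKernel_comp_real_singleton hρ]

lemma sum_real_singleton (p : Measure (Fin S)) [IsProbabilityMeasure p] :
    ∑ i, p.real {i} = 1 := by
  rw [sum_measureReal_singleton, Finset.coe_univ, probReal_univ]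

lemma real_singleton_eq_zero {q p : Measure (Fin S)} [IsFiniteMeasure p] (h : q ≪ p) (i : Fin S)
    (hi : p.real {i} = 0) : q.real {i} = 0 := by
  rw [measureReal_eq_zero_iff] at hi
  rw [measureReal_def, h hi, ENNReal.toReal_zero]

/-- A chi-square contraction estimate valid at all probability vectors bounds `etaKL` at every
input: the estimate is applied along the segment joining the two inputs. -/
theorem etaKL_forwardKernel_le (hρ : α t / α s ∈ Set.Icc (0 : ℝ) 1) (π p : Measure (Fin S))
    [IsProbabilityMeasure π] [IsProbabilityMeasure p] {C : ℝ}
    (h : ∀ w d : Fin S → ℝ, (∀ i, 0 ≤ w i) → ∑ i, w i = 1 → ∑ i, d i = 0 →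
      (∀ i, w i = 0 → d i = 0) →
      ∑ i, (α t / α s * d i) ^ 2 / stepVec (α t / α s) (fun i => π.real {i}) w i
        ≤ C * ∑ i, d i ^ 2 / w i) :
    etaKL p (forwardKernel α π s t) ≤ ENNReal.ofReal C := by
  refine iSup_le fun q => iSup_le fun h0 => iSup_le fun htop => ?_
  have hqp : (q : Measure (Fin S)) ≪ p := (klDiv_ne_top_iff.1 htop).1
  rw [ENNReal.div_le_iff h0 htop, klDiv_forwardKernel_comp hρ π hqp, klDiv_eq_ofReal_finKL hqp,
    ← ENNReal.ofReal_mul' (finKL_nonneg (fun _ => measureReal_nonneg) fun _ => measureReal_nonneg)]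
  refine ENNReal.ofReal_le_ofReal ?_
  have h1 : 0 ≤ 1 - α t / α s := sub_nonneg.2 hρ.2
  have hstep : ∀ (m : Measure (Fin S)) i,
      0 ≤ stepVec (α t / α s) (fun i => π.real {i}) (fun i => m.real {i}) i := fun m i =>
    add_nonneg (mul_nonneg hρ.1 measureReal_nonneg) (mul_nonneg h1 measureReal_nonneg)
  refine finKL_le_of_segmentChiSq_le (fun _ => measureReal_nonneg) (fun _ => measureReal_nonneg)
    (real_singleton_eq_zero hqp) (hstep q) (hstep p) ?_ fun u hu => ?_
  · intro i hi
    have := real_singleton_eq_zero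
      (forwardKernel_comp_absolutelyContinuous (α := α) (s := s) (t := t) π hqp) i
    simp only [forwardKernel_comp_real_singleton hρ] at this
    exact this hi
  · have hconv : ∀ i, p.real {i} + u * ((q : Measure (Fin S)).real {i} - p.real {i})
        = (1 - u) * p.real {i} + u * (q : Measure (Fin S)).real {i} := fun i => by ring
    have hu1 : 0 < 1 - u := sub_pos.2 hu.2
    have := h (fun i => p.real {i} + u * ((q : Measure (Fin S)).real {i} - p.real {i}))
      (fun i => (q : Measure (Fin S)).real {i} - p.real {i})
      (fun i => by
        rw [hconv]
        exact add_nonneg (mul_nonneg hu1.le measureReal_nonneg)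
          (mul_nonneg hu.1.le measureReal_nonneg))
      (by
        rw [Finset.sum_add_distrib, ← Finset.mul_sum, Finset.sum_sub_distrib,
          sum_real_singleton, sum_real_singleton]
        ring)
      (by rw [Finset.sum_sub_distrib, sum_real_singleton, sum_real_singleton, sub_self])
      (fun i hi => by
        rw [hconv] at hi
        have hp : p.real {i} = 0 := by
          have h2 := mul_nonneg hu.1.le (measureReal_nonneg (μ := (q : Measure (Fin S))) (s := {i}))
          have h3 := mul_nonneg hu1.le (measureReal_nonneg (μ := p) (s := {i}))
          exact (mul_eq_zero.1 (show (1 - u) * p.real {i} = 0 by linarith)).resolve_left hu1.ne'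
        simp only [hp, real_singleton_eq_zero hqp i hp, sub_self])
    refine Eq.trans_le ?_ this
    refine Finset.sum_congr rfl fun i _ => ?_
    simp only [stepVec]
    congr 1 <;> ring

theorem etaKL_forwardKernel_le_ratio (hρ : α t / α s ∈ Set.Icc (0 : ℝ) 1) (π p : Measure (Fin S))
    [IsProbabilityMeasure π] [IsProbabilityMeasure p] :
    etaKL p (forwardKernel α π s t) ≤ ENNReal.ofReal (α t / α s) := by
  refine etaKL_forwardKernel_le hρ π p fun w d hw _ _ hwd => ?_
  rw [Finset.mul_sum]
  refine Finset.sum_le_sum fun i _ => ?_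
  rcases hρ.1.eq_or_lt with h0 | h0
  · simp [← h0]
  by_cases hi : w i = 0
  · simp [hwd i hi]
  have hwi := (hw i).lt_of_ne' hi
  have hc : 0 ≤ (1 - α t / α s) * π.real {i} :=
    mul_nonneg (sub_nonneg.2 hρ.2) measureReal_nonneg
  calc (α t / α s * d i) ^ 2 / stepVec (α t / α s) (fun i => π.real {i}) w i
      ≤ (α t / α s * d i) ^ 2 / (α t / α s * w i) :=
        div_le_div_of_nonneg_left (sq_nonneg _) (mul_pos h0 hwi) (le_add_of_nonneg_right hc)
    _ = α t / α s * (d i ^ 2 / w i) := by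
        generalize α t / α s = ρ at h0
        field_simp

lemma uniformOn_univ_real_singleton (i : Fin S) :
    (uniformOn (Set.univ : Set (Fin S))).real {i} = 1 / S := by
  rw [measureReal_def, uniformOn_univ]
  simp

theorem etaKL_uniformKernel_le (hρ : α t / α s ∈ Set.Icc (0 : ℝ) 1) (p : Measure (Fin S))
    [IsProbabilityMeasure p] :
    etaKL p (uniformKernel S α s t)
      ≤ ENNReal.ofReal (S * (α t / α s) ^ 2 / ((S - 2) * (α t / α s) + 2)) := by
  have hne : Nonempty (Fin S) := p.nonempty_of_neZero
  have hS : (1 : ℝ) ≤ S := by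
    exact_mod_cast Nat.one_le_iff_ne_zero.2 (Fin.pos_iff_nonempty.2 hne).ne'
  have : IsProbabilityMeasure (uniformOn (Set.univ : Set (Fin S))) :=
    isProbabilityMeasure_uniformOn Set.finite_univ Set.univ_nonempty
  refine etaKL_forwardKernel_le hρ _ p fun w d hw hw1 hd hwd => ?_
  obtain ⟨h0, h1⟩ := hρ
  generalize α t / α s = ρ at h0 h1
  have hc : 0 ≤ (1 - ρ) * (1 / S) := mul_nonneg (sub_nonneg.2 h1) (by positivity)
  have hA' : 0 < (S - 2) * ρ + 2 := by nlinarith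
  have hA : ρ + 2 * ((1 - ρ) * (1 / S)) = ((S - 2) * ρ + 2) / S := by
    field_simp
    ring
  have hA0 : 0 < ρ + 2 * ((1 - ρ) * (1 / S)) := by rw [hA]; positivity
  have key := mul_le_mul_of_nonneg_left
    (sum_sq_div_le_of_sum_eq_zero h0 hc hA0 hw hw1 hd hwd) (sq_nonneg ρ)
  rw [hA, Finset.mul_sum] at key
  calc ∑ i, (ρ * d i) ^ 2 / stepVec ρ (fun i => (uniformOn Set.univ).real {i}) w i
      = ∑ i, ρ ^ 2 * (d i ^ 2 / (ρ * w i + (1 - ρ) * (1 / S))) :=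
        Finset.sum_congr rfl fun i _ => by
          rw [stepVec, uniformOn_univ_real_singleton, mul_pow, mul_div_assoc]
    _ ≤ _ := key
    _ = _ := by field_simp

/-- A single perturbation of the input bounds `etaKL` from below. -/
lemma ofReal_le_etaKL_forwardKernel (hρ : α t / α s ∈ Set.Icc (0 : ℝ) 1) (π p : Measure (Fin S))
    [IsProbabilityMeasure π] [IsProbabilityMeasure p] (q : Measure (Fin S))
    [IsProbabilityMeasure q] (hqp : q ≪ p) {r : ℝ}
    (h0 : 0 < finKL (fun i => q.real {i}) fun i => p.real {i})
    (hr : r * finKL (fun i => q.real {i}) (fun i => p.real {i})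
      ≤ finKL (stepVec (α t / α s) (fun i => π.real {i}) fun i => q.real {i})
          (stepVec (α t / α s) (fun i => π.real {i}) fun i => p.real {i})) :
    ENNReal.ofReal r ≤ etaKL p (forwardKernel α π s t) := by
  have hq := klDiv_eq_ofReal_finKL hqp
  have h1 : klDiv q p ≠ 0 := by simpa [hq] using h0
  have h2 : klDiv q p ≠ ∞ := by simp [hq]
  refine le_iSup_of_le (⟨q, inferInstance⟩ : ProbabilityMeasure (Fin S)) <|
    le_iSup_of_le h1 <| le_iSup_of_le h2 ?_
  change ENNReal.ofReal r ≤ klDiv (forwardKernel α π s t ∘ₘ q) _ / klDiv q p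
  rw [ENNReal.le_div_iff_mul_le (.inl h1) (.inl h2), klDiv_forwardKernel_comp hρ π hqp, hq,
    ← ENNReal.ofReal_mul' h0.le]
  exact ENNReal.ofReal_le_ofReal hr

theorem klDiv_forwardKernel_comp_le (π p q : Measure (Fin S)) [IsProbabilityMeasure q]
    [IsProbabilityMeasure p] [IsProbabilityMeasure π]
    (h : klDiv q p ≠ ∞ ∨ etaKL p (forwardKernel α π s t) ≠ 0) :
    klDiv (forwardKernel α π s t ∘ₘ q) (forwardKernel α π s t ∘ₘ p)
      ≤ etaKL p (forwardKernel α π s t) * klDiv q p := by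
  by_cases htop : klDiv q p = ∞
  · rw [htop, ENNReal.mul_top (h.resolve_left (not_not.2 htop))]
    exact le_top
  by_cases h0 : klDiv q p = 0
  · rw [klDiv_eq_zero_iff.1 h0, klDiv_self]
    exact zero_le
  rw [← ENNReal.div_le_iff h0 htop]
  exact le_iSup_of_le (⟨q, inferInstance⟩ : ProbabilityMeasure (Fin S)) <|
    le_iSup_of_le h0 <| le_iSup_of_le htop le_rfl

/-- If `q` and `p` agree at the mask state, masking multiplies their divergence by exactly the
retention probability `ρ`: the mask coordinate contributes nothing on either side. -/
lemma finKL_stepVec_dirac {ρ : ℝ} {M : Fin S} {q p : Fin S → ℝ} (h : q M = p M) :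
    finKL (stepVec ρ (fun i => (Measure.dirac M).real {i}) q)
      (stepVec ρ (fun i => (Measure.dirac M).real {i}) p) = ρ * finKL q p := by
  have self : ∀ x : ℝ, x * klFun (x / x) = 0 := fun x => by
    by_cases hx : x = 0
    · simp [hx]
    · simp [div_self hx, klFun_one]
  rw [finKL, finKL, Finset.mul_sum]
  refine Finset.sum_congr rfl fun i _ => ?_
  by_cases hi : i = M
  · subst hi
    simp [stepVec, h, self]
  · have : (Measure.dirac M).real {i} = 0 := by
      simp [measureReal_def, Ne.symm hi]
    simp only [stepVec, this, mul_zero, add_zero]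
    by_cases hρ : ρ = 0
    · simp [hρ]
    · rw [mul_div_mul_left _ _ hρ, mul_assoc]

theorem etaKL_maskingKernel_eq (hρ : α t / α s ∈ Set.Icc (0 : ℝ) 1) (M : Fin S)
    (p : Measure (Fin S)) [IsProbabilityMeasure p] {i j : Fin S} (hij : i ≠ j) (hiM : i ≠ M)
    (hjM : j ≠ M) (hi : p {i} ≠ 0) (hj : p {j} ≠ 0) :
    etaKL p (maskingKernel α M s t) = ENNReal.ofReal (α t / α s) := by
  refine le_antisymm (etaKL_forwardKernel_le_ratio hρ _ p) ?_
  -- The perturbation moves all the mass at `j` to `i`.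
  set q : Measure (Fin S) := p.restrict {j}ᶜ + p {j} • Measure.dirac i with hq
  have hq1 : IsProbabilityMeasure q := ⟨by
    simp [hq, add_comm (p {j}ᶜ), prob_add_prob_compl (measurableSet_singleton j)]⟩
  have hqne : ∀ k, k ≠ i → k ≠ j → q {k} = p {k} := fun k hki hkj => by
    have : {k} ⊆ ({j} : Set (Fin S))ᶜ := Set.singleton_subset_iff.2 hkj
    simp [hq, hki.symm, Set.inter_eq_left.2 this]
  have hqj : q {j} = 0 := by simp [hq, hij]
  have hqp : q ≪ p := by
    refine absolutelyContinuous_of_singleton fun k hk => ?_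
    have hki : k ≠ i := fun h => hi (h ▸ hk)
    have hkj : k ≠ j := fun h => hj (h ▸ hk)
    rw [hqne k hki hkj, hk]
  refine ofReal_le_etaKL_forwardKernel hρ _ p q hqp ?_ (finKL_stepVec_dirac ?_).ge
  · rw [← ENNReal.ofReal_pos, ← klDiv_eq_ofReal_finKL hqp, pos_iff_ne_zero, Ne,
      klDiv_eq_zero_iff]
    intro h
    exact hj (h ▸ hqj)
  · rw [measureReal_def, measureReal_def, hqne M hiM.symm hjM.symm]

/-- Inputs that are almost entirely masked witness that the input-independent constant of masking
is at least `α t / α s`, even with a single unmasked state. The input gives mass `exp (-L)` to `i`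
and the rest to `M`, and the perturbation is the point mass at `i`; their divergence is `L`, and
that of their images is at least `α t / α s * (L - 1)`. -/
theorem ofReal_le_etaKLSup_maskingKernel (hρ : α t / α s ∈ Set.Icc (0 : ℝ) 1) {i M : Fin S}
    (hiM : i ≠ M) : ENNReal.ofReal (α t / α s) ≤ etaKLSup (maskingKernel α M s t) := by
  have key : ∀ L : ℝ, 0 < L →
      ENNReal.ofReal (α t / α s * (1 - 1 / L)) ≤ etaKLSup (maskingKernel α M s t) := by
    intro L hL
    have ha0 := Real.exp_pos (-L)
    have ha1 : Real.exp (-L) < 1 := by simpa using hL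
    set a := Real.exp (-L) with ha
    set p : Measure (Fin S) := ENNReal.ofReal a • Measure.dirac i
      + ENNReal.ofReal (1 - a) • Measure.dirac M with hp
    have hp1 : IsProbabilityMeasure p := ⟨by
      simp [hp, ← ENNReal.ofReal_add ha0.le (sub_nonneg.2 ha1.le)]⟩
    have pi : p.real {i} = a := by simp [hp, measureReal_def, hiM.symm, ha0.le]
    have pM : p.real {M} = 1 - a := by simp [hp, measureReal_def, hiM, ha1.le]
    have pk : ∀ k, k ≠ i ∧ k ≠ M → p.real {k} = 0 := fun k hk => by
      simp [hp, measureReal_def, hk.1.symm, hk.2.symm]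
    have qi : (Measure.dirac i).real {i} = 1 := by simp [measureReal_def]
    have qne : ∀ k, k ≠ i → (Measure.dirac i).real {k} = 0 := fun k hk => by
      simp [measureReal_def, hk.symm]
    have hqp : Measure.dirac i ≪ p := by
      refine absolutelyContinuous_of_singleton fun k hk => ?_
      have hki : k ≠ i := by
        rintro rfl
        rw [← measureReal_eq_zero_iff, pi] at hk
        exact ha0.ne' hk
      simp [hki.symm]
    have hkl : a * klFun (1 / a) = L - 1 + a := by
      rw [klFun_apply, one_div, Real.log_inv, ha, Real.log_exp]
      field_simp
      ring
    have hin : finKL (fun k => (Measure.dirac i).real {k}) (fun k => p.real {k}) = L := by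
      rw [finKL, Fintype.sum_eq_add i M hiM fun k hk => by rw [pk k hk, zero_mul], pi, pM, qi,
        qne M hiM.symm, hkl, zero_div, klFun_zero]
      ring
    have hout : α t / α s * (L - 1 + a)
        ≤ finKL (stepVec (α t / α s) (fun k => (Measure.dirac M).real {k})
            fun k => (Measure.dirac i).real {k})
          (stepVec (α t / α s) (fun k => (Measure.dirac M).real {k}) fun k => p.real {k}) := by
      have hstep : ∀ (m : Measure (Fin S)) k, 0 ≤ stepVec (α t / α s)
          (fun k => (Measure.dirac M).real {k}) (fun k => m.real {k}) k := fun m k =>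
        add_nonneg (mul_nonneg hρ.1 measureReal_nonneg)
          (mul_nonneg (sub_nonneg.2 hρ.2) measureReal_nonneg)
      -- All terms are nonnegative, and the one at `i` suffices.
      refine le_trans (le_of_eq ?_) (Finset.single_le_sum (fun k _ => mul_nonneg (hstep p k)
        (klFun_nonneg (div_nonneg (hstep _ k) (hstep p k)))) (Finset.mem_univ i))
      have Mi : (Measure.dirac M).real {i} = 0 := by simp [measureReal_def, hiM.symm]
      simp only [stepVec, Mi, qi, pi, mul_zero, add_zero]
      by_cases h0 : α t / α s = 0
      · simp [h0]
      · rw [mul_div_mul_left _ _ h0, mul_assoc, hkl]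
    refine (ofReal_le_etaKL_forwardKernel hρ (Measure.dirac M) p (Measure.dirac i) hqp
      (by rwa [hin]) ?_).trans (le_iSup (fun p : ProbabilityMeasure (Fin S) =>
        etaKL (p : Measure (Fin S)) (maskingKernel α M s t)) ⟨p, hp1⟩)
    rw [hin]
    refine le_trans ?_ hout
    rw [mul_assoc]
    refine mul_le_mul_of_nonneg_left ?_ hρ.1
    rw [sub_mul, one_div_mul_cancel hL.ne']
    linarith
  have hlim : Filter.Tendsto (fun L : ℝ => ENNReal.ofReal (α t / α s * (1 - 1 / L))) Filter.atTop
      (nhds (ENNReal.ofReal (α t / α s))) := by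
    refine ENNReal.tendsto_ofReal ?_
    simpa using ((tendsto_inv_atTop_zero (𝕜 := ℝ)).const_sub 1).const_mul (α t / α s)
  exact le_of_tendsto hlim ((Filter.eventually_gt_atTop 0).mono key)

theorem etaKLSup_forwardKernel_le_maskingKernel (hρ : α t / α s ∈ Set.Icc (0 : ℝ) 1) (M : Fin S)
    (π : Measure (Fin S)) [IsProbabilityMeasure π] :
    etaKLSup (forwardKernel α π s t) ≤ etaKLSup (maskingKernel α M s t) := by
  by_cases h : ∃ i, i ≠ M
  · obtain ⟨i, hi⟩ := h
    exact (iSup_le fun p : ProbabilityMeasure (Fin S) =>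
      etaKL_forwardKernel_le_ratio hρ π (p : Measure (Fin S))).trans
      (ofReal_le_etaKLSup_maskingKernel hρ hi)
  · -- With a single state all distributions coincide, so no perturbation has nonzero divergence.
    push Not at h
    refine iSup_le fun p => iSup_le fun q => iSup_le fun h0 => absurd ?_ h0
    rw [klDiv_eq_zero_iff]
    refine Measure.ext_of_singleton fun i => ?_
    have hi : ({i} : Set (Fin S)) = Set.univ := by
      ext k
      simp [h k, h i]
    rw [hi, measure_univ, measure_univ]

end Forward

theorem theorem1 {S : ℕ} (α : ℝ → ℝ) (hα : IsNoiseSchedule α)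
    (s t : ℝ) (hs : 0 ≤ s) (hst : s ≤ t) (ht : t ≤ 1) (hαs : 0 < α s) :
    -- contraction for every stationary distribution, input `p` and perturbation `q`;
    -- the side condition only excludes a right-hand side of the form `0 * ∞`
    (∀ π p q : ProbabilityMeasure (Fin S),
      (klDiv (q : Measure (Fin S)) p ≠ ∞ ∨
        etaKL (p : Measure (Fin S))
          (forwardKernel α π s t) ≠ 0) →
      klDiv (forwardKernel α π s t ∘ₘ (q : Measure (Fin S)))
          (forwardKernel α π s t ∘ₘ (p : Measure (Fin S)))
        ≤ etaKL (p : Measure (Fin S))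
            (forwardKernel α π s t) * klDiv (q : Measure (Fin S)) p) ∧
    -- masking diffusion, exact constant
    (∀ (M : Fin S) (p : ProbabilityMeasure (Fin S)),
      (∃ i j : Fin S, i ≠ j ∧ i ≠ M ∧ j ≠ M ∧
        (p : Measure (Fin S)) {i} ≠ 0 ∧ (p : Measure (Fin S)) {j} ≠ 0) →
      etaKL (p : Measure (Fin S)) (maskingKernel α M s t)
        = ENNReal.ofReal (α t / α s)) ∧
    -- uniform diffusion, upper bound
    (∀ p : ProbabilityMeasure (Fin S),
      etaKL (p : Measure (Fin S)) (uniformKernel S α s t)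
        ≤ ENNReal.ofReal (S * (α t / α s) ^ 2 / ((S - 2) * (α t / α s) + 2))) ∧
    -- `α t / α s` bounds every constant, and masking is the worst case,
    -- for the individual inputs and for the input-independent constants
    (∀ π p : ProbabilityMeasure (Fin S),
      etaKL (p : Measure (Fin S)) (forwardKernel α π s t)
        ≤ ENNReal.ofReal (α t / α s)) ∧
    (∀ (M : Fin S) (π p : ProbabilityMeasure (Fin S)),
      (∃ i j : Fin S, i ≠ j ∧ i ≠ M ∧ j ≠ M ∧
        (p : Measure (Fin S)) {i} ≠ 0 ∧ (p : Measure (Fin S)) {j} ≠ 0) →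
      etaKL (p : Measure (Fin S)) (forwardKernel α π s t)
        ≤ etaKL (p : Measure (Fin S))
            (maskingKernel α M s t)) ∧
    (∀ (M : Fin S) (π : ProbabilityMeasure (Fin S)),
      etaKLSup (forwardKernel α (π : Measure (Fin S)) s t)
        ≤ etaKLSup (maskingKernel α M s t)) := by
  have hρ := div_mem_Icc_of_isNoiseSchedule hα hs hst ht hαs
  refine ⟨fun π p q h => klDiv_forwardKernel_comp_le _ _ _ h, ?_, fun p =>
    etaKL_uniformKernel_le hρ _, fun π p => etaKL_forwardKernel_le_ratio hρ _ _, ?_,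
    fun M π => etaKLSup_forwardKernel_le_maskingKernel hρ M _⟩
  · rintro M p ⟨i, j, hij, hiM, hjM, hi, hj⟩
    exact etaKL_maskingKernel_eq hρ M _ hij hiM hjM hi hj
  · rintro M π p ⟨i, j, hij, hiM, hjM, hi, hj⟩
    rw [etaKL_maskingKernel_eq hρ M _ hij hiM hjM hi hj]
    exact etaKL_forwardKernel_le_ratio hρ _ _
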